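/- For $d\ge 2$ let $(\mathbb{C}^2)^{\otimes d}$ carry the standard Hermitian inner product $\langle \mathcal X,\mathcal Y\rangle=\sum_{i}\overline{x_{i}}\,y_{i}$ (with the sum over all $i\in\{0,1\}^d$), with norm $\|\mathcal X\|=\sqrt{\langle \mathcal X,\mathcal X\rangle}$. A $d$-qubit state is a tensor $\mathcal X\in(\mathbb{C}^2)^{\otimes d}$ with $\|\mathcal X\|=1$, and a product state is a tensor $x_1\otimes\cdots\otimes x_d$ with $x_j\in\mathbb{C}^2$ and $\|x_j\|=1$ for all $j$. Define the spectral norm and the nuclear norm of $\mathcal X$ by $$\|\mathcal X\|_{\infty}=\max\{|\langle \mathcal Y,\mathcal X\rangle| : \mathcal Y \text{ a product state}\},$$ $$\|\mathcal X\|_{1}=\inf\Big\{\sum_{i=1}^r\|\mathcal X_i\| : r\in\mathbb{N},\ \mathcal X=\sum_{i=1}^r \mathcal X_i,\ \text{each } \mathcal X_i\ne 0 \text{ of the form } x_1\otimes\cdots\otimes x_d\Big\},$$ and put $$\alpha_{\infty,2^{\times d},\mathbb{C}}=\min_{\|\mathcal X\|=1}\|\mathcal X\|_\infty,\qquad \beta_{1,2^{\times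 d},\mathbb{C}}=\max_{\|\mathcal X\|=1}\|\mathcal X\|_1 .$$ The geometric measure of entanglement of a state is its Euclidean distance to the set of product states; a state is maximally geometrically entangled if it maximizes this measure among all $d$-qubit states. **Theorem.** Let $\mathcal M_4$ be the Higuchi–Sudbery 4-qubit state $$\mathcal M_4=\frac1{\sqrt6}\Big(|0011\rangle+|1100\rangle+\zeta\big(|1010\rangle+|0101\rangle\big)+\zeta^2\big(|1001\rangle+|0110\rangle\big)\Big),\qquad \zeta=e^{2\pi i/3}.$$ Then $$\|\mathcal M_4\|_\infty=\frac{\sqrt2}{3}=\frac1{\sqrt2}\,\alpha_{\infty,2^{\times 3},\mathbb{C}},\qquad \alpha_{\infty,2^{\times 4},\mathbb{C}}=\frac{\sqrt2}{3},\qquad \beta_{1,2^{\times 4},\mathbb{C}}=\frac{3}{\sqrt2},$$ and $\mathcal M_4$ is a most entangled 4-qubit state: it is maximally geometrically entangled, and $\|\mathcal M_4\|_1=\beta_{1,2^{\times 4},\mathbb{C}}$. -/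

import Mathlib

namespace TensorEntanglement

noncomputable section

/-- The space `ℂ^n = ⊗ⱼ ℂ^{n j}` of complex `d`-mode tensors, as arrays of coordinates,
with the inner product `⟨X, Y⟩ = ∑ᵢ conj (X i) * Y i` and the Euclidean norm. -/
abbrev Tensor {d : ℕ} (n : Fin d → ℕ) : Type :=
  EuclideanSpace ℂ ((j : Fin d) → Fin (n j))

/-- The format `2^{×d} = (2, …, 2)` of `d`-qubits. -/
abbrev qubits (d : ℕ) : Fin d → ℕ := fun _ => 2

/-- The tensor `x₁ ⊗ ⋯ ⊗ x_d`. -/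
def pureTensor {d : ℕ} {n : Fin d → ℕ} (x : (j : Fin d) → EuclideanSpace ℂ (Fin (n j))) :
    Tensor n :=
  WithLp.toLp 2 (fun i => ∏ j, x j (i j))

/-- Product states: tensors `x₁ ⊗ ⋯ ⊗ x_d` with all `‖xⱼ‖ = 1`. -/
def productStates {d : ℕ} (n : Fin d → ℕ) : Set (Tensor n) :=
  {X | ∃ x : (j : Fin d) → EuclideanSpace ℂ (Fin (n j)), (∀ j, ‖x j‖ = 1) ∧ X = pureTensor x}

/-- Rank-one tensors: nonzero tensors of the form `x₁ ⊗ ⋯ ⊗ x_d`. -/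
def IsRankOne {d : ℕ} {n : Fin d → ℕ} (X : Tensor n) : Prop :=
  X ≠ 0 ∧ ∃ x : (j : Fin d) → EuclideanSpace ℂ (Fin (n j)), X = pureTensor x

/-- The spectral norm: the maximum of `|⟨Y, X⟩|` over all product states `Y`. -/
def spectralNorm {d : ℕ} {n : Fin d → ℕ} (X : Tensor n) : ℝ :=
  sSup ((fun Y : Tensor n => ‖inner ℂ Y X‖) '' productStates n)

/-- The nuclear norm: the infimum of `∑ᵢ ‖Zᵢ‖` over all decompositions `X = ∑ᵢ Zᵢ` into finitely
many rank-one tensors. -/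
def nuclearNorm {d : ℕ} {n : Fin d → ℕ} (X : Tensor n) : ℝ :=
  sInf {s : ℝ | ∃ (r : ℕ) (Z : Fin r → Tensor n),
    (∀ i, IsRankOne (Z i)) ∧ X = ∑ i, Z i ∧ s = ∑ i, ‖Z i‖}

/-- The minimum of the spectral norm over all states (tensors of Euclidean norm one). -/
def alphaSpectral {d : ℕ} (n : Fin d → ℕ) : ℝ :=
  sInf (spectralNorm '' {X : Tensor n | ‖X‖ = 1})

/-- The maximum of the nuclear norm over all states. -/
def betaNuclear {d : ℕ} (n : Fin d → ℕ) : ℝ :=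
  sSup (nuclearNorm '' {X : Tensor n | ‖X‖ = 1})

/-- The geometric measure of entanglement: the Euclidean distance to the product states. -/
def geometricEntanglement {d : ℕ} {n : Fin d → ℕ} (X : Tensor n) : ℝ :=
  Metric.infDist X (productStates n)

/-- A maximally geometrically entangled state. -/
def IsMaximallyGeometricallyEntangled {d : ℕ} {n : Fin d → ℕ} (X : Tensor n) : Prop :=
  ‖X‖ = 1 ∧ ∀ Y : Tensor n, ‖Y‖ = 1 → geometricEntanglement Y ≤ geometricEntanglement X

/-- The standard basis vector `|b₁ … b_d⟩` of the space of `d`-qubits. -/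
def ket {d : ℕ} (b : Fin d → Fin 2) : Tensor (qubits d) :=
  EuclideanSpace.single b 1

/-- The cube root of unity `e^{2πi/3}`. -/
def zeta : ℂ := Complex.exp (2 * Real.pi * Complex.I / 3)

/-- The Higuchi–Sudbery 4-qubit state. -/
def higuchiSudbery : Tensor (qubits 4) :=
  (1 / (Real.sqrt 6 : ℂ)) •
    (ket ![0, 0, 1, 1] + ket ![1, 1, 0, 0]
      + zeta • (ket ![1, 0, 1, 0] + ket ![0, 1, 0, 1])
      + zeta ^ 2 • (ket ![1, 0, 0, 1] + ket ![0, 1, 1, 0]))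

end

end TensorEntanglement

namespace TensorEntanglement

/-! Everything follows from a sharp lower bound for the spectral norm and a state attaining it.
Distances to product states depend only on the spectral norm (`geometricEntanglement_eq`), and
nuclear norms are controlled by convex duality (`nuclearNorm_le_inv`, `inv_le_nuclearNorm`).

Lower bound: a 3-qubit tensor has spectral norm at least `2/3` of its norm (`exists_trilinear_ge`).
If not, every unit contraction `M` of its first slot has operator norm below `2/3`, so `det (4/9 -
M* M) > 0`. Since `det M` is a quadratic form in the contracting vector, Takagi diagonalisation
gives contractions `M`, `N` with no mixed term. Averaging over two superpositions of them, with a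
phase that opposes the determinants, violates the inequality for a suitable weight `p`. For 4
qubits, one slice carries half the squared norm, which costs a factor `√2`.

Upper bound: the Higuchi–Sudbery form is built from `SL(2)`-invariant brackets. In a unitary frame
adapted to one argument, it has the same absolute bound as the form of the `W` state, which attains
`2/3` on 3 qubits. -/

/-! ### A scalar inequality behind the 3-qubit bound -/

theorem exists_weight_le_zero_of_ge {u v a b : ℝ} (ha : 0 ≤ a) (hb : 0 ≤ b) (hau : 2 * a ≤ u)
    (hbv : 2 * b ≤ v) (huv : u + v = 1) (hle : v ≤ u) :
    ∃ p : ℝ, 0 ≤ p ∧ p ≤ 1 ∧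
      (4 / 9) ^ 2 - 4 / 9 * (p * u + (1 - p) * v) + (p * a - (1 - p) * b) ^ 2 ≤ 0 := by
  have hv : v = 1 - u := by linarith
  subst hv
  have hu1 : u ≤ 1 := by linarith
  rcases le_or_gt u (3 / 5) with h | h
  -- This weight balances `p * u = (1 - p) * v = u * v`. With `q = u * v`, it remains that `16/81 -
  -- 8q/9 + q²/4 ≤ 0` on `[6/25, 1/4]`.
  · refine ⟨1 - u, by linarith, by linarith, ?_⟩
    have h1 : ((1 - u) * a - (1 - (1 - u)) * b) ^ 2 ≤ ((u * (1 - u)) / 2) ^ 2 := by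
      apply sq_le_sq'
      · nlinarith
      · nlinarith
    have h2 : 6 / 25 ≤ u * (1 - u) := by nlinarith
    have h3 : u * (1 - u) ≤ 1 / 4 := by nlinarith [sq_nonneg (u - 1 / 2)]
    nlinarith
  · have hu : 0 < u := by linarith
    -- The minimiser in `p` after the square is replaced by its bound `(p * u / 2) ^ 2`. The
    -- resulting minimum vanishes at `u = 2/3`, the value for the `W` state, so there is no slack.
    obtain ⟨p, hp⟩ : ∃ p : ℝ, p * u ^ 2 = 8 * (2 * u - 1) / 9 :=
      ⟨8 * (2 * u - 1) / 9 / u ^ 2, by field_simp⟩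
    have hu2 : 0 < u ^ 2 := by positivity
    have hp0 : 0 ≤ p := by
      by_contra hneg
      push Not at hneg
      nlinarith
    have hp1 : p ≤ 1 := by
      by_contra hneg
      push Not at hneg
      nlinarith [sq_nonneg (u - 8 / 9)]
    refine ⟨p, hp0, hp1, ?_⟩
    have hpv : (1 - p) * (1 - u) ≤ p * u := by
      suffices 1 - u ≤ p by nlinarith
      by_contra hneg
      push Not at hneg
      have : p * u ^ 2 < (1 - u) * u ^ 2 := by nlinarith
      nlinarith [mul_nonneg (sub_nonneg.2 h.le) (sub_nonneg.2 hu1)]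
    have h1 : (p * a - (1 - p) * b) ^ 2 ≤ (p * u / 2) ^ 2 := by
      apply sq_le_sq'
      · nlinarith
      · nlinarith
    have h2 : (p * u / 2) ^ 2 = p * (2 * (2 * u - 1) / 9) := by
      calc (p * u / 2) ^ 2 = p * (p * u ^ 2) / 4 := by ring
        _ = _ := by rw [hp]; ring
    have h3 : u ^ 2 * ((4 / 9) ^ 2 - 4 / 9 * (p * u + (1 - p) * (1 - u))
        + p * (2 * (2 * u - 1) / 9)) = -(4 / 81) * ((3 * u - 2) ^ 2 * (1 - u)) := by
      linear_combination (-2 / 9 * (2 * u - 1)) * hp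
    have h4 : 0 ≤ (3 * u - 2) ^ 2 * (1 - u) := mul_nonneg (sq_nonneg _) (by linarith)
    by_contra hneg
    push Not at hneg
    have : 0 < (4 / 9) ^ 2 - 4 / 9 * (p * u + (1 - p) * (1 - u))
        + p * (2 * (2 * u - 1) / 9) := by linarith
    nlinarith [mul_pos hu2 this]

/-- Here `u`, `v` stand for squared Frobenius norms of two orthogonal contractions, `a`, `b` for the
moduli of their determinants, and `p` for the squared amplitude of the first in a superposition. -/
theorem exists_weight_le_zero {u v a b : ℝ} (ha : 0 ≤ a) (hb : 0 ≤ b) (hau : 2 * a ≤ u)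
    (hbv : 2 * b ≤ v) (huv : u + v = 1) :
    ∃ p : ℝ, 0 ≤ p ∧ p ≤ 1 ∧
      (4 / 9) ^ 2 - 4 / 9 * (p * u + (1 - p) * v) + (p * a - (1 - p) * b) ^ 2 ≤ 0 := by
  rcases le_total v u with h | h
  · exact exists_weight_le_zero_of_ge ha hb hau hbv huv h
  · obtain ⟨p, h0, h1, hp⟩ := exists_weight_le_zero_of_ge hb ha hbv hau (by linarith) h
    exact ⟨1 - p, by linarith, by linarith, by nlinarith⟩

/-! ### `2 × 2` matrices and binary quadratic forms -/

theorem exists_unit_phase (z : ℂ) : ∃ c : ℂ, ‖c‖ = 1 ∧ z = ‖z‖ * c :=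
  ⟨Complex.exp (z.arg * Complex.I), Complex.norm_exp_ofReal_mul_I _,
    (Complex.norm_mul_exp_arg_mul_I z).symm⟩

theorem eq_inv_mul_of_unit {c z : ℂ} (hc : ‖c‖ = 1) : starRingEnd ℂ c * (c * z) = z := by
  rw [← mul_assoc, ← Complex.normSq_eq_conj_mul_self, Complex.normSq_eq_norm_sq, hc]
  simp

/-- A `2 × 2` matrix whose operator norm is less than `√s` satisfies `det (s - M* M) > 0`. -/
theorem det_gap_pos {s : ℝ} (m : Fin 2 → Fin 2 → ℂ)
    (H : ∀ y z : Fin 2 → ℂ, y ≠ 0 → z ≠ 0 →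
      ‖∑ j, ∑ k, m j k * y j * z k‖ ^ 2 < s * (∑ j, ‖y j‖ ^ 2) * ∑ k, ‖z k‖ ^ 2) :
    0 < s ^ 2 - s * (∑ j, ∑ k, ‖m j k‖ ^ 2) + ‖m 0 0 * m 1 1 - m 0 1 * m 1 0‖ ^ 2 := by
  have hs : 0 < s := by
    have := H ![1, 0] ![1, 0] (fun h => by simpa using congrFun h 0)
      (fun h => by simpa using congrFun h 0)
    simp [Fin.sum_univ_two] at this
    nlinarith [sq_nonneg ‖m 0 0‖]
  have hcol : ∀ z : Fin 2 → ℂ, z ≠ 0 →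
      ‖m 0 0 * z 0 + m 0 1 * z 1‖ ^ 2 + ‖m 1 0 * z 0 + m 1 1 * z 1‖ ^ 2
        < s * (‖z 0‖ ^ 2 + ‖z 1‖ ^ 2) := by
    intro z hz
    set r : Fin 2 → ℂ := fun j => m j 0 * z 0 + m j 1 * z 1 with hr
    have hzpos : 0 < ‖z 0‖ ^ 2 + ‖z 1‖ ^ 2 := by
      by_contra hneg
      apply hz
      have h0 := sq_nonneg ‖z 0‖
      have h1 := sq_nonneg ‖z 1‖
      have h0' : ‖z 0‖ ^ 2 = 0 := by linarith
      have h1' : ‖z 1‖ ^ 2 = 0 := by linarith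
      ext j
      fin_cases j
      · simpa using h0'
      · simpa using h1'
    change ‖r 0‖ ^ 2 + ‖r 1‖ ^ 2 < _
    by_cases hr0 : ‖r 0‖ ^ 2 + ‖r 1‖ ^ 2 = 0
    · rw [hr0]; positivity
    · have hrpos : 0 < ‖r 0‖ ^ 2 + ‖r 1‖ ^ 2 := lt_of_le_of_ne (by positivity) (Ne.symm hr0)
      -- Pairing `r = m z` with its own conjugate turns the bilinear bound into an operator norm
      -- bound.
      have h := H (fun j => starRingEnd ℂ (r j)) z (fun h => hr0 (by
        have h0 := congrFun h 0
        have h1 := congrFun h 1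
        simp only [Pi.zero_apply, map_eq_zero] at h0 h1
        simp [h0, h1])) hz
      have heq : ∑ j, ∑ k, m j k * starRingEnd ℂ (r j) * z k
          = ((‖r 0‖ ^ 2 + ‖r 1‖ ^ 2 : ℝ) : ℂ) := by
        push_cast
        rw [← Complex.mul_conj', ← Complex.mul_conj']
        simp only [Fin.sum_univ_two, hr]
        ring
      rw [heq, Complex.norm_real, Real.norm_of_nonneg hrpos.le] at h
      simp only [Fin.sum_univ_two, RCLike.norm_conj] at h
      nlinarith
  have hA := hcol ![1, 0] (fun h => by simpa using congrFun h 0)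
  simp at hA
  set D : ℂ := starRingEnd ℂ (m 0 0) * m 0 1 + starRingEnd ℂ (m 1 0) * m 1 1 with hD
  set A : ℝ := s - ‖m 0 0‖ ^ 2 - ‖m 1 0‖ ^ 2 with hAdef
  have hApos : 0 < A := by linarith
  -- The vector `(D, A)` is annihilated by the first row `(A, -D)` of `s - M* M`, so the Hermitian
  -- form there equals `A * det (s - M* M)`.
  have h := hcol ![D, A] (fun h => by
    have := congrFun h 1
    simp at this
    exact hApos.ne' this)
  simp only [Matrix.cons_val_zero, Matrix.cons_val_one] at h
  have key : s * (‖D‖ ^ 2 + ‖(A : ℂ)‖ ^ 2) -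
      (‖m 0 0 * D + m 0 1 * A‖ ^ 2 + ‖m 1 0 * D + m 1 1 * A‖ ^ 2) =
      A * (s ^ 2 - s * (∑ j, ∑ k, ‖m j k‖ ^ 2) + ‖m 0 0 * m 1 1 - m 0 1 * m 1 0‖ ^ 2) := by
    simp only [Fin.sum_univ_two, hAdef, hD, Complex.sq_norm, Complex.normSq_apply, Complex.mul_re,
      Complex.mul_im, Complex.add_re, Complex.add_im, Complex.sub_re, Complex.sub_im,
      Complex.conj_re, Complex.conj_im, Complex.ofReal_re, Complex.ofReal_im]
    ring
  have : 0 < A * (s ^ 2 - s * (∑ j, ∑ k, ‖m j k‖ ^ 2)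
      + ‖m 0 0 * m 1 1 - m 0 1 * m 1 0‖ ^ 2) := by rw [← key]; linarith
  exact pos_of_mul_pos_right this hApos.le

theorem isCompact_unit_pairs : IsCompact {e : ℂ × ℂ | ‖e.1‖ ^ 2 + ‖e.2‖ ^ 2 = 1} := by
  apply Metric.isCompact_of_isClosed_isBounded
  · exact isClosed_eq (by fun_prop) continuous_const
  · refine (Metric.isBounded_closedBall (x := (0 : ℂ × ℂ)) (r := 1)).subset ?_
    rintro ⟨x, y⟩ h
    simp only [Set.mem_ofPred_eq] at h
    rw [mem_closedBall_zero_iff, Prod.norm_def, max_le_iff]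
    constructor <;> nlinarith [norm_nonneg x, norm_nonneg y]

/-- Takagi diagonalisation of a binary complex quadratic form: there is an orthonormal basis
`(x, y)`, `(-ȳ, x̄)` in which the mixed coefficient vanishes. -/
theorem exists_unitary_diagonalising (A B C : ℂ) :
    ∃ x y : ℂ, ‖x‖ ^ 2 + ‖y‖ ^ 2 = 1 ∧
      2 * A * x * (-starRingEnd ℂ y) + B * (x * starRingEnd ℂ x + y * (-starRingEnd ℂ y))
        + 2 * C * y * starRingEnd ℂ x = 0 := by
  let q : ℂ × ℂ → ℂ := fun e => A * e.1 ^ 2 + B * e.1 * e.2 + C * e.2 ^ 2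
  obtain ⟨⟨x, y⟩, hxy, hmax⟩ := isCompact_unit_pairs.exists_isMaxOn (f := fun e => ‖q e‖)
    ⟨(1, 0), by simp⟩ (by fun_prop)
  simp only [Set.mem_ofPred_eq] at hxy
  refine ⟨x, y, hxy, ?_⟩
  set m := 2 * A * x * (-starRingEnd ℂ y) + B * (x * starRingEnd ℂ x + y * (-starRingEnd ℂ y))
        + 2 * C * y * starRingEnd ℂ x with hm
  set d := q (x, y) with hd
  set d' := q (-starRingEnd ℂ y, starRingEnd ℂ x) with hd'
  obtain ⟨c, hc, hcd⟩ := exists_unit_phase d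
  obtain ⟨c', hc', hcm⟩ := exists_unit_phase m
  -- The phase aligning the first-order term `w * m` with the maximal value `d`. Moving from `(x,
  -- y)` towards `w` times the orthogonal vector would then increase `‖q‖` to first order unless `m
  -- = 0`.
  set w := c * starRingEnd ℂ c' with hw
  have hwn : ‖w‖ = 1 := by simp [hw, hc, hc']
  have hwm : w * m = ‖m‖ * c := by
    have h1 := eq_inv_mul_of_unit (z := 1) hc'
    calc w * m = w * (‖m‖ * c') := by rw [← hcm]
      _ = ‖m‖ * c * (starRingEnd ℂ c' * (c' * 1)) := by rw [hw]; ring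
      _ = _ := by rw [h1, mul_one]
  have hbound : ∀ t : ℝ, 0 < t → ‖m‖ ≤ t * (‖d‖ + ‖d'‖) := by
    intro t ht
    set n := Real.sqrt (1 + t ^ 2) with hn
    have hnpos : 0 < n := by positivity
    have hn2 : n ^ 2 = 1 + t ^ 2 := Real.sq_sqrt (by positivity)
    set e : ℂ × ℂ := ((x + t * w * (-starRingEnd ℂ y)) / n, (y + t * w * starRingEnd ℂ x) / n)
    have hwsq : w.re ^ 2 + w.im ^ 2 = 1 := by
      have : ‖w‖ ^ 2 = 1 := by rw [hwn]; norm_num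
      rw [Complex.sq_norm, Complex.normSq_apply] at this
      linarith
    have hxysq : x.re ^ 2 + x.im ^ 2 + (y.re ^ 2 + y.im ^ 2) = 1 := by
      rw [Complex.sq_norm, Complex.sq_norm, Complex.normSq_apply, Complex.normSq_apply] at hxy
      linarith
    have hnum : ‖x + t * w * (-starRingEnd ℂ y)‖ ^ 2 + ‖y + t * w * starRingEnd ℂ x‖ ^ 2
        = 1 + t ^ 2 := by
      simp only [Complex.sq_norm, Complex.normSq_apply, Complex.mul_re,
        Complex.mul_im, Complex.add_re, Complex.add_im, Complex.neg_re, Complex.neg_im,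
        Complex.conj_re, Complex.conj_im, Complex.ofReal_re, Complex.ofReal_im]
      linear_combination (1 + t ^ 2 * (w.re ^ 2 + w.im ^ 2)) * hxysq + t ^ 2 * hwsq
    have he : ‖e.1‖ ^ 2 + ‖e.2‖ ^ 2 = 1 := by
      simp only [e, norm_div, div_pow, Complex.norm_real, Real.norm_of_nonneg hnpos.le]
      rw [← add_div, hnum, hn2, div_self (by positivity)]
    have hle : ‖q e‖ ≤ ‖d‖ := hmax he
    have hqe : (n : ℂ) ^ 2 * q e = d + t * (w * m) + t ^ 2 * w ^ 2 * d' := by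
      have : (n : ℂ) ≠ 0 := by exact_mod_cast hnpos.ne'
      simp only [q, e, hd, hd', hm]
      field_simp
      ring
    have hnorm : ‖d + t * (w * m)‖ = ‖d‖ + t * ‖m‖ := by
      rw [hwm]
      nth_rewrite 1 [hcd]
      have : (‖d‖ : ℂ) * c + t * (‖m‖ * c) = ((‖d‖ + t * ‖m‖ : ℝ) : ℂ) * c := by push_cast; ring
      rw [this, norm_mul, hc, mul_one, Complex.norm_real, Real.norm_of_nonneg (by positivity)]
    have h1 : ‖d + t * (w * m) + t ^ 2 * w ^ 2 * d'‖ ≤ (1 + t ^ 2) * ‖d‖ := by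
      rw [← hqe, norm_mul, norm_pow, Complex.norm_real, Real.norm_of_nonneg hnpos.le, hn2]
      gcongr
    have h2 : ‖d + t * (w * m)‖ ≤ ‖d + t * (w * m) + t ^ 2 * w ^ 2 * d'‖
        + ‖(t : ℂ) ^ 2 * w ^ 2 * d'‖ := by
      calc _ = ‖(d + t * (w * m) + t ^ 2 * w ^ 2 * d') - t ^ 2 * w ^ 2 * d'‖ := by congr 1; ring
        _ ≤ _ := norm_sub_le _ _
    rw [hnorm, norm_mul, norm_mul, norm_pow, norm_pow, hwn, Complex.norm_real,
      Real.norm_of_nonneg ht.le] at h2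
    have h3 : t * ‖m‖ ≤ t * (t * (‖d‖ + ‖d'‖)) := by nlinarith
    exact le_of_mul_le_mul_left h3 ht
  have hk : 0 ≤ ‖d‖ + ‖d'‖ := by positivity
  by_contra hne
  have hmpos : 0 < ‖m‖ := norm_pos_iff.2 hne
  have h := hbound (‖m‖ / (2 * (‖d‖ + ‖d'‖ + 1))) (by positivity)
  rw [div_mul_eq_mul_div, le_div_iff₀ (by positivity)] at h
  nlinarith

/-! ### The trilinear lower bound `2/3` -/

theorem two_mul_norm_det_le (a b c d : ℂ) :
    2 * ‖a * d - b * c‖ ≤ (‖a‖ ^ 2 + ‖b‖ ^ 2) + (‖c‖ ^ 2 + ‖d‖ ^ 2) := by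
  have h := norm_sub_le (a * d) (b * c)
  rw [norm_mul, norm_mul] at h
  nlinarith [sq_nonneg (‖a‖ - ‖d‖), sq_nonneg (‖b‖ - ‖c‖)]

theorem exists_unit_sqrt {c : ℂ} (hc : ‖c‖ = 1) : ∃ w : ℂ, ‖w‖ = 1 ∧ w ^ 2 = c := by
  obtain ⟨w, hw⟩ := IsAlgClosed.exists_pow_nat_eq c (n := 2) (by norm_num)
  refine ⟨w, ?_, hw⟩
  have : ‖w‖ ^ 2 = 1 := by rw [← norm_pow, hw, hc]
  nlinarith [norm_nonneg w]

/-- Every array `t` of Euclidean norm one attains, as a trilinear form, at least `2/3` times the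
product of the norms of its arguments. -/
theorem exists_trilinear_ge (t : Fin 2 → Fin 2 → Fin 2 → ℂ)
    (ht : ∑ i, ∑ j, ∑ k, ‖t i j k‖ ^ 2 = 1) :
    ∃ x y z : Fin 2 → ℂ, x ≠ 0 ∧ y ≠ 0 ∧ z ≠ 0 ∧
      4 / 9 * (∑ i, ‖x i‖ ^ 2) * (∑ j, ‖y j‖ ^ 2) * (∑ k, ‖z k‖ ^ 2) ≤
        ‖∑ i, ∑ j, ∑ k, t i j k * x i * y j * z k‖ ^ 2 := by
  by_contra hcon
  push Not at hcon
  have hgap : ∀ x : Fin 2 → ℂ, ∑ i, ‖x i‖ ^ 2 = 1 →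
      0 < (4 / 9 : ℝ) ^ 2 - 4 / 9 * (∑ j, ∑ k, ‖x 0 * t 0 j k + x 1 * t 1 j k‖ ^ 2)
        + ‖(x 0 * t 0 0 0 + x 1 * t 1 0 0) * (x 0 * t 0 1 1 + x 1 * t 1 1 1)
          - (x 0 * t 0 0 1 + x 1 * t 1 0 1) * (x 0 * t 0 1 0 + x 1 * t 1 1 0)‖ ^ 2 := by
    intro x hx
    refine det_gap_pos (s := 4 / 9) (fun j k => x 0 * t 0 j k + x 1 * t 1 j k) ?_
    intro y z hy hz
    have h := hcon x y z (by rintro rfl; simp at hx) hy hz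
    rw [hx, mul_one] at h
    refine lt_of_eq_of_lt ?_ h
    congr 2
    simp only [Fin.sum_univ_two]
    ring
  -- The three arguments are the coefficients of `det (x 0 * t 0 + x 1 * t 1)` as a quadratic form
  -- in `x`.
  obtain ⟨e, e', he, hmix⟩ := exists_unitary_diagonalising
    (t 0 0 0 * t 0 1 1 - t 0 0 1 * t 0 1 0)
    (t 0 0 0 * t 1 1 1 + t 1 0 0 * t 0 1 1 - t 0 0 1 * t 1 1 0 - t 1 0 1 * t 0 1 0)
    (t 1 0 0 * t 1 1 1 - t 1 0 1 * t 1 1 0)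
  set f := -starRingEnd ℂ e' with hf
  set f' := starRingEnd ℂ e with hf'
  set M : Fin 2 → Fin 2 → ℂ := fun j k => e * t 0 j k + e' * t 1 j k with hM
  set N : Fin 2 → Fin 2 → ℂ := fun j k => f * t 0 j k + f' * t 1 j k with hN
  have hesq : e.re ^ 2 + e.im ^ 2 + (e'.re ^ 2 + e'.im ^ 2) = 1 := by
    rw [Complex.sq_norm, Complex.sq_norm, Complex.normSq_apply, Complex.normSq_apply] at he
    linarith
  have hrot : ∀ a b : ℂ, ‖e * a + e' * b‖ ^ 2 + ‖f * a + f' * b‖ ^ 2 = ‖a‖ ^ 2 + ‖b‖ ^ 2 := by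
    intro a b
    simp only [hf, hf', Complex.sq_norm, Complex.normSq_apply, Complex.mul_re,
      Complex.mul_im, Complex.add_re, Complex.add_im, Complex.neg_re, Complex.neg_im,
      Complex.conj_re, Complex.conj_im]
    linear_combination (a.re ^ 2 + a.im ^ 2 + b.re ^ 2 + b.im ^ 2) * hesq
  set u := (‖M 0 0‖ ^ 2 + ‖M 0 1‖ ^ 2) + (‖M 1 0‖ ^ 2 + ‖M 1 1‖ ^ 2) with hu
  set v := (‖N 0 0‖ ^ 2 + ‖N 0 1‖ ^ 2) + (‖N 1 0‖ ^ 2 + ‖N 1 1‖ ^ 2) with hv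
  have huv : u + v = 1 := by
    simp only [Fin.sum_univ_two] at ht
    have h00 := hrot (t 0 0 0) (t 1 0 0)
    have h01 := hrot (t 0 0 1) (t 1 0 1)
    have h10 := hrot (t 0 1 0) (t 1 1 0)
    have h11 := hrot (t 0 1 1) (t 1 1 1)
    simp only [hu, hv, hM, hN]
    linarith
  set d := M 0 0 * M 1 1 - M 0 1 * M 1 0 with hd
  set d' := N 0 0 * N 1 1 - N 0 1 * N 1 0 with hd'
  obtain ⟨p, hp0, hp1, hp⟩ := exists_weight_le_zero (norm_nonneg d) (norm_nonneg d')
    (two_mul_norm_det_le _ _ _ _) (two_mul_norm_det_le _ _ _ _) huv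
  obtain ⟨c, hc, hcd⟩ := exists_unit_phase d
  obtain ⟨c', hc', hcd'⟩ := exists_unit_phase d'
  -- The phase enters the determinant squared, and `w ^ 2` makes the contribution of `d'` opposite
  -- to that of `d`. Replacing `w` by `-w` leaves the determinant unchanged.
  obtain ⟨w, hw, hw2⟩ := exists_unit_sqrt (c := -c * starRingEnd ℂ c') (by simp [hc, hc'])
  have hwd : w ^ 2 * d' = -‖d'‖ * c := by
    have h1 := eq_inv_mul_of_unit (z := 1) hc'
    calc w ^ 2 * d' = w ^ 2 * (‖d'‖ * c') := by rw [← hcd']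
      _ = -‖d'‖ * c * (starRingEnd ℂ c' * (c' * 1)) := by rw [hw2]; ring
      _ = _ := by rw [h1, mul_one]
  obtain ⟨α, hα0, hα⟩ : ∃ α : ℝ, 0 ≤ α ∧ α ^ 2 = p :=
    ⟨Real.sqrt p, Real.sqrt_nonneg _, Real.sq_sqrt hp0⟩
  obtain ⟨β, hβ0, hβ⟩ : ∃ β : ℝ, 0 ≤ β ∧ β ^ 2 = 1 - p :=
    ⟨Real.sqrt (1 - p), Real.sqrt_nonneg _, Real.sq_sqrt (by linarith)⟩
  have hwsq : w.re ^ 2 + w.im ^ 2 = 1 := by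
    have : ‖w‖ ^ 2 = 1 := by rw [hw]; norm_num
    rw [Complex.sq_norm, Complex.normSq_apply] at this
    linarith
  have hdet : ∀ σ : ℝ, σ ^ 2 = 1 →
      0 < (4 / 9 : ℝ) ^ 2 - 4 / 9 * (∑ j, ∑ k, ‖α * M j k + σ * (β * w * N j k)‖ ^ 2)
        + (p * ‖d‖ - (1 - p) * ‖d'‖) ^ 2 := by
    intro σ hσ
    have h := hgap ![α * e + σ * (β * w * f), α * e' + σ * (β * w * f')] (by
      simp only [Fin.sum_univ_two, Matrix.cons_val_zero, Matrix.cons_val_one,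
        hf, hf', Complex.sq_norm, Complex.normSq_apply, Complex.mul_re,
        Complex.mul_im, Complex.add_re, Complex.add_im, Complex.neg_re, Complex.neg_im,
        Complex.conj_re, Complex.conj_im, Complex.ofReal_re, Complex.ofReal_im]
      linear_combination (α ^ 2 + σ ^ 2 * β ^ 2 * (w.re ^ 2 + w.im ^ 2)) * hesq
        + σ ^ 2 * β ^ 2 * hwsq + β ^ 2 * hσ + hα + hβ)
    simp only [Matrix.cons_val_zero, Matrix.cons_val_one] at h
    have hσc : (σ : ℂ) ^ 2 = 1 := by exact_mod_cast hσ
    have hαc : (α : ℂ) ^ 2 = p := by exact_mod_cast hα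
    have hβc : (β : ℂ) ^ 2 = 1 - p := by exact_mod_cast hβ
    have h1 : ((α * e + σ * (β * w * f)) * t 0 0 0 + (α * e' + σ * (β * w * f')) * t 1 0 0)
        * ((α * e + σ * (β * w * f)) * t 0 1 1 + (α * e' + σ * (β * w * f')) * t 1 1 1)
        - ((α * e + σ * (β * w * f)) * t 0 0 1 + (α * e' + σ * (β * w * f')) * t 1 0 1)
        * ((α * e + σ * (β * w * f)) * t 0 1 0 + (α * e' + σ * (β * w * f')) * t 1 1 0)
        = ((p * ‖d‖ - (1 - p) * ‖d'‖ : ℝ) : ℂ) * c := by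
      have h2 : (((p * ‖d‖ - (1 - p) * ‖d'‖ : ℝ) : ℂ)) * c = p * d + (1 - p) * (w ^ 2 * d') := by
        rw [hwd]
        nth_rewrite 2 [hcd]
        push_cast
        ring
      rw [h2, hd, hd']
      simp only [hM, hN]
      linear_combination (α * σ * β * w) * hmix
        + β ^ 2 * w ^ 2 * ((f * t 0 0 0 + f' * t 1 0 0) * (f * t 0 1 1 + f' * t 1 1 1)
          - (f * t 0 0 1 + f' * t 1 0 1) * (f * t 0 1 0 + f' * t 1 1 0)) * hσc
        + ((e * t 0 0 0 + e' * t 1 0 0) * (e * t 0 1 1 + e' * t 1 1 1)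
          - (e * t 0 0 1 + e' * t 1 0 1) * (e * t 0 1 0 + e' * t 1 1 0)) * hαc
        + w ^ 2 * ((f * t 0 0 0 + f' * t 1 0 0) * (f * t 0 1 1 + f' * t 1 1 1)
          - (f * t 0 0 1 + f' * t 1 0 1) * (f * t 0 1 0 + f' * t 1 1 0)) * hβc
    rw [h1, norm_mul, hc, mul_one, Complex.norm_real, Real.norm_eq_abs, sq_abs] at h
    have hs : ∀ j k, (α * e + σ * (β * w * f)) * t 0 j k + (α * e' + σ * (β * w * f')) * t 1 j k
        = α * M j k + σ * (β * w * N j k) := by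
      intro j k
      simp only [hM, hN]
      ring
    simpa only [hs] using h
  have hpos := hdet 1 (by norm_num)
  have hneg := hdet (-1) (by norm_num)
  -- Adding the inequalities for both signs removes the cross terms of the Frobenius norms and
  -- contradicts `hp`.
  have hpar : ∀ a b : ℂ, ‖α * a + (1 : ℝ) * (β * w * b)‖ ^ 2
      + ‖α * a + (-1 : ℝ) * (β * w * b)‖ ^ 2 = 2 * (p * ‖a‖ ^ 2 + (1 - p) * ‖b‖ ^ 2) := by
    intro a b
    have h := parallelogram_law_with_norm ℝ (α * a) (β * w * b)
    rw [norm_mul, norm_mul, norm_mul, hw, Complex.norm_real, Complex.norm_real,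
      Real.norm_of_nonneg hα0, Real.norm_of_nonneg hβ0] at h
    have e1 : α * a + ((1 : ℝ) : ℂ) * (β * w * b) = α * a + β * w * b := by push_cast; ring
    have e2 : α * a + ((-1 : ℝ) : ℂ) * (β * w * b) = α * a - β * w * b := by push_cast; ring
    rw [e1, e2]
    linear_combination h + 2 * ‖a‖ ^ 2 * hα + 2 * ‖b‖ ^ 2 * hβ
  have h00 := hpar (M 0 0) (N 0 0)
  have h01 := hpar (M 0 1) (N 0 1)
  have h10 := hpar (M 1 0) (N 1 0)
  have h11 := hpar (M 1 1) (N 1 1)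
  simp only [Fin.sum_univ_two] at hpos hneg
  linarith

/-! ### The form of the `W` state -/

/-- The bound for the trilinear form of the `W` state at real vectors. -/
theorem w_form_sq_le {a a' b b' c c' : ℝ} (ha : a ^ 2 + a' ^ 2 = 1) (hb : b ^ 2 + b' ^ 2 = 1)
    (hc : c ^ 2 + c' ^ 2 = 1) :
    (a' * b * c + a * b' * c + a * b * c') ^ 2 ≤ 4 / 3 := by
  -- In angles, `D` and `F` are the cosine and sine of a sum and `E` is the cosine of a difference,
  -- with `b * c = (D + E) / 2`.
  set D := b * c - b' * c' with hD
  set E := b * c + b' * c' with hE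
  set F := b' * c + b * c' with hF
  have h1 : D ^ 2 + F ^ 2 = 1 := by
    simp only [hD, hF]; linear_combination (c ^ 2 + c' ^ 2) * hb + hc
  have h2 : E ^ 2 ≤ 1 := by
    have : E ^ 2 + (b' * c - b * c') ^ 2 = 1 := by
      simp only [hE]; linear_combination (c ^ 2 + c' ^ 2) * hb + hc
    nlinarith [sq_nonneg (b' * c - b * c')]
  have h3 : (a' * (D / 2) + a * F) ^ 2 ≤ a' ^ 2 / 4 + a ^ 2 := by
    have : a' ^ 2 / 4 + a ^ 2 = (a' * (D / 2) + a * F) ^ 2 + (a' / 2 * F - a * D) ^ 2 := by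
      linear_combination (-(a' ^ 2 / 4 + a ^ 2)) * h1
    nlinarith [sq_nonneg (a' / 2 * F - a * D)]
  have h4 : (a' * b * c + a * b' * c + a * b * c') = a' * E / 2 + (a' * (D / 2) + a * F) := by
    simp only [hD, hE, hF]; ring
  rw [h4]
  have h5 : (a' * E) ^ 2 ≤ a' ^ 2 := by nlinarith [mul_le_mul_of_nonneg_left h2 (sq_nonneg a')]
  -- Cauchy-Schwarz with weights `1/3` and `1`
  nlinarith [sq_nonneg (3 * (a' * E / 2) - (a' * (D / 2) + a * F))]

/-! ### Product states, distance and duality -/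

section General

variable {d : ℕ} {n : Fin d → ℕ}

theorem norm_pureTensor (x : (j : Fin d) → EuclideanSpace ℂ (Fin (n j))) :
    ‖pureTensor x‖ = ∏ j, ‖x j‖ := by
  have h : ‖pureTensor x‖ ^ 2 = (∏ j, ‖x j‖) ^ 2 := by
    rw [EuclideanSpace.norm_sq_eq, ← Finset.prod_pow]
    simp only [EuclideanSpace.norm_sq_eq, pureTensor, norm_prod, ← Finset.prod_pow]
    rw [Finset.prod_univ_sum, Fintype.piFinset_univ]
  exact (pow_left_inj₀ (norm_nonneg _) (Finset.prod_nonneg fun j _ => norm_nonneg _)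
    two_ne_zero).1 h

theorem pureTensor_smul (a : Fin d → ℂ) (x : (j : Fin d) → EuclideanSpace ℂ (Fin (n j))) :
    pureTensor (fun j => a j • x j) = (∏ j, a j) • pureTensor x := by
  ext i
  simp [pureTensor, Finset.prod_mul_distrib]

theorem norm_of_mem_productStates {Y : Tensor n} (hY : Y ∈ productStates n) : ‖Y‖ = 1 := by
  obtain ⟨x, hx, rfl⟩ := hY
  simp [norm_pureTensor, hx]

theorem smul_mem_productStates [NeZero d] {Y : Tensor n} (hY : Y ∈ productStates n) {c : ℂ}
    (hc : ‖c‖ = 1) : c • Y ∈ productStates n := by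
  obtain ⟨x, hx, rfl⟩ := hY
  refine ⟨fun j => (if j = 0 then c else 1) • x j, fun j => ?_, ?_⟩
  · rw [norm_smul, hx, mul_one]
    split_ifs <;> simp [hc]
  · rw [pureTensor_smul, Finset.prod_ite_eq' Finset.univ (0 : Fin d) (fun _ => c)]
    simp

theorem norm_inner_le_spectralNorm {Y : Tensor n} (hY : Y ∈ productStates n) (X : Tensor n) :
    ‖inner ℂ Y X‖ ≤ spectralNorm X := by
  refine le_csSup ⟨‖X‖, ?_⟩ ⟨Y, hY, rfl⟩
  rintro _ ⟨Z, hZ, rfl⟩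
  simpa [norm_of_mem_productStates hZ] using norm_inner_le_norm (𝕜 := ℂ) Z X

theorem spectralNorm_nonneg (X : Tensor n) : 0 ≤ spectralNorm X :=
  Real.sSup_nonneg (by rintro _ ⟨Z, -, rfl⟩; exact norm_nonneg _)

theorem spectralNorm_le {X : Tensor n} {c : ℝ} (hc : 0 ≤ c)
    (h : ∀ Y ∈ productStates n, ‖inner ℂ Y X‖ ≤ c) : spectralNorm X ≤ c :=
  Real.sSup_le (by rintro _ ⟨Z, hZ, rfl⟩; exact h Z hZ) hc

theorem norm_inner_pureTensor_le (x : (j : Fin d) → EuclideanSpace ℂ (Fin (n j)))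
    (X : Tensor n) : ‖inner ℂ (pureTensor x) X‖ ≤ ‖pureTensor x‖ * spectralNorm X := by
  by_cases h : ∀ j, x j ≠ 0
  · have hx : pureTensor x = ((∏ j, ‖x j‖ : ℝ) : ℂ) • pureTensor (fun j => (‖x j‖⁻¹ : ℂ) • x j) := by
      rw [Complex.ofReal_prod, ← pureTensor_smul]
      congr 1
      ext1 j
      rw [smul_inv_smul₀]
      simpa using h j
    have hmem : pureTensor (fun j => (‖x j‖⁻¹ : ℂ) • x j) ∈ productStates n := by
      refine ⟨_, fun j => ?_, rfl⟩
      have := norm_ne_zero_iff.2 (h j)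
      simp [norm_smul, this]
    rw [norm_pureTensor, hx, inner_smul_left, norm_mul, RCLike.norm_conj, Complex.norm_real,
      Real.norm_of_nonneg (Finset.prod_nonneg fun j _ => norm_nonneg _)]
    exact mul_le_mul_of_nonneg_left (norm_inner_le_spectralNorm hmem X)
      (Finset.prod_nonneg fun j _ => norm_nonneg _)
  · push Not at h
    obtain ⟨j, hj⟩ := h
    have : pureTensor x = 0 := by
      rw [← norm_eq_zero, norm_pureTensor]
      exact Finset.prod_eq_zero (Finset.mem_univ j) (by simp [hj])
    simp [this]

/-- Every complex number becomes its absolute value after a rotation of the first argument. -/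
theorem exists_rotation_inner_eq_norm (Y X : Tensor n) :
    ∃ c : ℂ, ‖c‖ = 1 ∧ inner ℂ (c • Y) X = (‖inner ℂ Y X‖ : ℂ) := by
  obtain ⟨c, hc, h⟩ := exists_unit_phase (inner ℂ Y X)
  refine ⟨c, hc, ?_⟩
  rw [inner_smul_left]
  calc starRingEnd ℂ c * inner ℂ Y X = starRingEnd ℂ c * (c * ‖inner ℂ Y X‖) := by
        rw [mul_comm c, ← h]
    _ = _ := eq_inv_mul_of_unit hc

theorem dist_sq_of_unit {X Y : Tensor n} (hX : ‖X‖ = 1) (hY : ‖Y‖ = 1) :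
    dist X Y ^ 2 = 2 - 2 * (inner ℂ Y X).re := by
  rw [dist_comm, dist_eq_norm, norm_sub_sq (𝕜 := ℂ), hX, hY]
  simp
  ring

/-- For unit vectors the squared distance is `2 - 2 Re ⟨Y, X⟩`, and rotating the phase of `Y` raises
the real part to the modulus. -/
theorem geometricEntanglement_eq [NeZero d] (hn : (productStates n).Nonempty) {X : Tensor n}
    (hX : ‖X‖ = 1) : geometricEntanglement X = Real.sqrt (2 - 2 * spectralNorm X) := by
  apply le_antisymm
  · apply Real.le_sqrt_of_sq_le
    have hle : spectralNorm X ≤ (2 - geometricEntanglement X ^ 2) / 2 := by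
      apply csSup_le (hn.image _)
      rintro _ ⟨Y, hY, rfl⟩
      obtain ⟨c, hc, h⟩ := exists_rotation_inner_eq_norm Y X
      have hmem := smul_mem_productStates hY hc
      have h1 : geometricEntanglement X ≤ dist X (c • Y) := Metric.infDist_le_dist_of_mem hmem
      have h2 := dist_sq_of_unit hX (norm_of_mem_productStates hmem)
      rw [h, Complex.ofReal_re] at h2
      have h3 : geometricEntanglement X ^ 2 ≤ dist X (c • Y) ^ 2 :=
        pow_le_pow_left₀ Metric.infDist_nonneg h1 2
      simp only
      linarith
    linarith
  · apply (Metric.le_infDist hn).2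
    intro Y hY
    apply Real.sqrt_le_iff.2 ⟨dist_nonneg, ?_⟩
    rw [dist_sq_of_unit hX (norm_of_mem_productStates hY)]
    linarith [norm_inner_le_spectralNorm hY X, Complex.re_le_norm (inner ℂ Y X)]

/-- If `X` were separated from the hull by the functional of `W`, phase invariance would give `c ‖W‖
≤ spectralNorm W ≤ u < Re ⟨W, X⟩ ≤ c ‖W‖`. -/
theorem mem_closure_convexHull_productStates [NeZero d] (hn : (productStates n).Nonempty) {c : ℝ}
    (h : ∀ X : Tensor n, c * ‖X‖ ≤ spectralNorm X) {X : Tensor n} (hX : ‖X‖ ≤ c) :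
    X ∈ closure (convexHull ℝ (productStates n)) := by
  by_contra hnot
  obtain ⟨f, u, hu, huX⟩ := RCLike.geometric_hahn_banach_closed_point (𝕜 := ℂ)
    (convex_convexHull ℝ (productStates n)).closure isClosed_closure hnot
  set W := (InnerProductSpace.toDual ℂ (Tensor n)).symm f
  have hW : ∀ Y, inner ℂ W Y = f Y := fun Y => InnerProductSpace.toDual_symm_apply
  have hle : spectralNorm W ≤ u := by
    apply csSup_le (hn.image _)
    rintro _ ⟨Y, hY, rfl⟩
    obtain ⟨c, hc, h⟩ := exists_rotation_inner_eq_norm Y W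
    have h1 := hu _ (subset_closure (subset_convexHull ℝ _ (smul_mem_productStates hY hc)))
    rw [← hW, ← inner_conj_symm, h] at h1
    simpa using h1.le
  have h1 : RCLike.re (f X) ≤ ‖W‖ * ‖X‖ := by
    rw [← hW]
    exact (RCLike.re_le_norm _).trans (norm_inner_le_norm _ _)
  have h2 := h W
  nlinarith [mul_le_mul_of_nonneg_left hX (norm_nonneg W)]

/-- The closure can be dropped inside the open ball: a convex set with nonempty interior has the
same interior as its closure. -/
theorem mem_convexHull_productStates [NeZero d] (hn : (productStates n).Nonempty) {c : ℝ}
    (h : ∀ X : Tensor n, c * ‖X‖ ≤ spectralNorm X) {X : Tensor n} (hX : ‖X‖ < c) :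
    X ∈ convexHull ℝ (productStates n) := by
  have hball : Metric.ball 0 c ⊆ interior (closure (convexHull ℝ (productStates n))) :=
    interior_maximal (fun Y hY => mem_closure_convexHull_productStates hn h
      (mem_ball_zero_iff.1 hY).le) Metric.isOpen_ball
  -- The affine span is closed in finite dimension, so it contains the ball and is everything; hence
  -- the hull has nonempty interior.
  have hspan : affineSpan ℝ (productStates n) = ⊤ := by
    have hsub : closure (convexHull ℝ (productStates n)) ⊆ affineSpan ℝ (productStates n) :=
      closure_minimal (convexHull_subset_affineSpan _)
        (AffineSubspace.closed_of_finiteDimensional _)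
    have htop := affineSpan_eq_top_of_nonempty_interior (V := Tensor n)
      (s := (affineSpan ℝ (productStates n) : Set (Tensor n)))
      ⟨X, interior_mono (hsub.trans (subset_convexHull ℝ _)) (hball (mem_ball_zero_iff.2 hX))⟩
    simpa using htop
  have hint := (convex_convexHull ℝ (productStates n)).interior_closure_eq_interior_of_nonempty_interior
    (interior_convexHull_nonempty_iff_affineSpan_eq_top.2 hspan)
  exact interior_subset (hint ▸ hball (mem_ball_zero_iff.2 hX))

theorem exists_rankOne_decomposition [NeZero d] {X : Tensor n}
    (hX : X ∈ convexHull ℝ (productStates n)) {a : ℝ} (ha : 0 < a) :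
    ∃ (r : ℕ) (Z : Fin r → Tensor n), (∀ i, IsRankOne (Z i)) ∧ a • X = ∑ i, Z i ∧
      a = ∑ i, ‖Z i‖ := by
  obtain ⟨ι, _, z, w, hz, -, hw, hw1, rfl⟩ := eq_pos_convex_span_of_mem_convexHull hX
  have hmem : ∀ i, z i ∈ productStates n := fun i => hz ⟨i, rfl⟩
  let e := (Fintype.equivFin ι).symm
  refine ⟨Fintype.card ι, fun i => (a * w (e i)) • z (e i), fun i => ⟨?_, ?_⟩, ?_, ?_⟩
  · rw [← norm_ne_zero_iff, norm_smul, norm_of_mem_productStates (hmem _), mul_one, norm_ne_zero_iff]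
    exact (mul_pos ha (hw _)).ne'
  · obtain ⟨x, -, hx⟩ := hmem (e i)
    refine ⟨fun j => (if j = 0 then ((a * w (e i) : ℝ) : ℂ) else 1) • x j, ?_⟩
    rw [pureTensor_smul,
      Finset.prod_ite_eq' Finset.univ (0 : Fin d) (fun _ => ((a * w (e i) : ℝ) : ℂ)), ← hx]
    simp only [Finset.mem_univ, if_true, Complex.coe_smul]
  · rw [e.sum_comp (fun i => (a * w i) • z i), Finset.smul_sum]
    simp only [mul_smul]
  · have : ∀ i, ‖(a * w (e i)) • z (e i)‖ = a * w (e i) := fun i => by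
      rw [norm_smul, norm_of_mem_productStates (hmem _), mul_one,
        Real.norm_of_nonneg (mul_pos ha (hw _)).le]
    simp only [this]
    rw [e.sum_comp (fun i => a * w i), ← Finset.mul_sum, hw1, mul_one]

theorem exists_rankOne_decomposition_of_unit [NeZero d] (hn : (productStates n).Nonempty) {c : ℝ}
    (h : ∀ X : Tensor n, c * ‖X‖ ≤ spectralNorm X) {X : Tensor n} (hX : ‖X‖ = 1) {b : ℝ}
    (hb : 0 < b) (hbc : b < c) :
    ∃ (r : ℕ) (Z : Fin r → Tensor n), (∀ i, IsRankOne (Z i)) ∧ X = ∑ i, Z i ∧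
      b⁻¹ = ∑ i, ‖Z i‖ := by
  have hmem : b • X ∈ convexHull ℝ (productStates n) :=
    mem_convexHull_productStates hn h (by rwa [norm_smul, hX, mul_one, Real.norm_of_nonneg hb.le])
  have := exists_rankOne_decomposition hmem (inv_pos.2 hb)
  rwa [inv_smul_smul₀ hb.ne'] at this

theorem nuclearNorm_le_inv [NeZero d] (hn : (productStates n).Nonempty) {c : ℝ} (hc : 0 < c)
    (h : ∀ X : Tensor n, c * ‖X‖ ≤ spectralNorm X) {X : Tensor n} (hX : ‖X‖ = 1) :
    nuclearNorm X ≤ c⁻¹ := by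
  have hb : ∀ b, 0 < b → b < c → b * nuclearNorm X ≤ 1 := by
    intro b hb hbc
    obtain ⟨r, Z, hZ⟩ := exists_rankOne_decomposition_of_unit hn h hX hb hbc
    have : nuclearNorm X ≤ b⁻¹ := by
      refine csInf_le ⟨0, ?_⟩ ⟨r, Z, hZ⟩
      rintro _ ⟨r, Z, -, -, rfl⟩
      exact Finset.sum_nonneg fun i _ => norm_nonneg _
    calc b * nuclearNorm X ≤ b * b⁻¹ := by gcongr
      _ = 1 := mul_inv_cancel₀ hb.ne'
  have hc1 : c * nuclearNorm X ≤ 1 := by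
    refine le_of_tendsto (f := fun b : ℝ => b * nuclearNorm X) (x := nhdsWithin c (Set.Iio c))
      (((continuous_id.mul continuous_const).tendsto c).mono_left nhdsWithin_le_nhds) ?_
    filter_upwards [Ioo_mem_nhdsLT hc] with b hb'
    exact hb b hb'.1 hb'.2
  rw [inv_eq_one_div, le_div_iff₀ hc]
  linarith

/-- Duality of the spectral and the nuclear norm, for a state paired with itself. -/
theorem inv_le_nuclearNorm [NeZero d] (hn : (productStates n).Nonempty) {c : ℝ} (hc : 0 < c)
    (h : ∀ X : Tensor n, c * ‖X‖ ≤ spectralNorm X) {X : Tensor n} (hX : ‖X‖ = 1)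
    (hXc : spectralNorm X ≤ c) : c⁻¹ ≤ nuclearNorm X := by
  -- The value `c / 2` is arbitrary: some decomposition must exist, because `sInf ∅ = 0` would break
  -- a lower bound.
  obtain ⟨r, Z, hZ⟩ := exists_rankOne_decomposition_of_unit hn h hX (half_pos hc) (half_lt_self hc)
  refine le_csInf ⟨_, r, Z, hZ⟩ ?_
  rintro _ ⟨r, Z, hZ, hsum, rfl⟩
  have h1 : (1 : ℝ) ≤ ∑ i, ‖Z i‖ * c := by
    calc (1 : ℝ) = ‖inner ℂ X X‖ := by rw [inner_self_eq_norm_sq_to_K, hX]; simp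
      _ = ‖∑ i, inner ℂ (Z i) X‖ := by
        rw [← sum_inner, ← hsum]
      _ ≤ ∑ i, ‖inner ℂ (Z i) X‖ := norm_sum_le _ _
      _ ≤ _ := by
        refine Finset.sum_le_sum fun i _ => ?_
        obtain ⟨-, x, hx⟩ := hZ i
        rw [hx]
        exact (norm_inner_pureTensor_le x X).trans (by gcongr)
  rw [← Finset.sum_mul] at h1
  rw [inv_eq_one_div, div_le_iff₀ hc]
  exact h1

theorem alphaSpectral_eq {c : ℝ} (h : ∀ X : Tensor n, c * ‖X‖ ≤ spectralNorm X) {X : Tensor n}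
    (hX : ‖X‖ = 1) (hXc : spectralNorm X ≤ c) : alphaSpectral n = c := by
  apply le_antisymm
  · have hbdd : BddBelow (spectralNorm '' {X : Tensor n | ‖X‖ = 1}) :=
      ⟨0, by rintro _ ⟨Y, -, rfl⟩; exact spectralNorm_nonneg Y⟩
    exact (csInf_le hbdd ⟨X, hX, rfl⟩).trans hXc
  · refine le_csInf ⟨_, X, hX, rfl⟩ ?_
    rintro _ ⟨Y, hY, rfl⟩
    have hY1 : ‖Y‖ = 1 := hY
    simpa [hY1] using h Y

end General

/-! ### Lower bounds for three and four qubits -/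

theorem productStates_qubits_nonempty (d : ℕ) : (productStates (qubits d)).Nonempty :=
  ⟨pureTensor fun _ => EuclideanSpace.single 0 1,
    fun _ => EuclideanSpace.single 0 1, fun _ => by simp, rfl⟩

theorem sum_qubits_three {M : Type*} [AddCommMonoid M] (f : (Fin 3 → Fin 2) → M) :
    ∑ i, f i = ∑ a, ∑ b, ∑ c, f ![a, b, c] := by
  rw [← (Fin.consEquiv (fun _ => Fin 2)).sum_comp, Fintype.sum_prod_type]
  refine Finset.sum_congr rfl fun a _ => ?_
  rw [← (Fin.consEquiv (fun _ => Fin 2)).sum_comp, Fintype.sum_prod_type]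
  refine Finset.sum_congr rfl fun b _ => ?_
  rw [← (Fin.consEquiv (fun _ => Fin 2)).sum_comp, Fintype.sum_prod_type]
  refine Finset.sum_congr rfl fun c _ => ?_
  rw [Fintype.sum_unique]
  congr 1

theorem sum_qubits_four {M : Type*} [AddCommMonoid M] (f : (Fin 4 → Fin 2) → M) :
    ∑ i, f i = ∑ a, ∑ b, ∑ c, ∑ e, f ![a, b, c, e] := by
  rw [← (Fin.consEquiv (fun _ => Fin 2)).sum_comp, Fintype.sum_prod_type]
  refine Finset.sum_congr rfl fun a _ => ?_
  rw [sum_qubits_three]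
  rfl

/-- The vector of `ℂ²` with conjugated coordinates. -/
noncomputable def conjVector (x : Fin 2 → ℂ) : EuclideanSpace ℂ (Fin 2) :=
  WithLp.toLp 2 fun i => starRingEnd ℂ (x i)

theorem norm_conjVector_sq (x : Fin 2 → ℂ) : ‖conjVector x‖ ^ 2 = ∑ i, ‖x i‖ ^ 2 := by
  simp [EuclideanSpace.norm_sq_eq, conjVector]

theorem sum_norm_sq_pos {x : Fin 2 → ℂ} (hx : x ≠ 0) : 0 < ∑ i, ‖x i‖ ^ 2 := by
  obtain ⟨i, hi⟩ := Function.ne_iff.1 hx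
  exact Finset.sum_pos' (fun i _ => by positivity)
    ⟨i, Finset.mem_univ i, by have := norm_pos_iff.2 hi; positivity⟩

theorem inner_pureTensor (d : ℕ) (x : Fin d → Fin 2 → ℂ) (X : Tensor (qubits d)) :
    inner ℂ (pureTensor (n := qubits d) fun j => conjVector (x j)) X
      = ∑ i, X i * ∏ j, x j (i j) := by
  simp [PiLp.inner_apply, pureTensor, conjVector]

/-- Conjugating the test vectors makes the pairing multilinear, and homogeneity spares their
normalisation. -/
theorem le_spectralNorm_sq_of_form {d : ℕ} (X : Tensor (qubits d)) {c : ℝ} (x : Fin d → Fin 2 → ℂ)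
    (hx : ∀ j, x j ≠ 0)
    (h : c * ∏ j, ∑ i, ‖x j i‖ ^ 2 ≤ ‖∑ i, X i * ∏ j, x j (i j)‖ ^ 2) :
    c ≤ spectralNorm X ^ 2 := by
  have h1 := norm_inner_pureTensor_le (n := qubits d) (fun j => conjVector (x j)) X
  have h2 := pow_le_pow_left₀ (norm_nonneg _) h1 2
  rw [inner_pureTensor, mul_pow, norm_pureTensor, ← Finset.prod_pow] at h2
  simp only [norm_conjVector_sq] at h2
  have hpos : 0 < ∏ j, ∑ i, ‖x j i‖ ^ 2 := Finset.prod_pos fun j _ => sum_norm_sq_pos (hx j)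
  nlinarith

theorem exists_trilinear_ge_mul (t : Fin 2 → Fin 2 → Fin 2 → ℂ) :
    ∃ x y z : Fin 2 → ℂ, x ≠ 0 ∧ y ≠ 0 ∧ z ≠ 0 ∧
      4 / 9 * (∑ i, ∑ j, ∑ k, ‖t i j k‖ ^ 2) *
        ((∑ i, ‖x i‖ ^ 2) * (∑ j, ‖y j‖ ^ 2) * (∑ k, ‖z k‖ ^ 2)) ≤
        ‖∑ i, ∑ j, ∑ k, t i j k * x i * y j * z k‖ ^ 2 := by
  set N := ∑ i, ∑ j, ∑ k, ‖t i j k‖ ^ 2 with hN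
  have hN0 : 0 ≤ N := by positivity
  rcases hN0.eq_or_lt with h | h
  · exact ⟨1, 1, 1, one_ne_zero, one_ne_zero, one_ne_zero, by rw [← h]; simp⟩
  · obtain ⟨s, hs, hsN⟩ : ∃ s : ℝ, 0 < s ∧ s ^ 2 = N :=
      ⟨Real.sqrt N, Real.sqrt_pos.2 h, Real.sq_sqrt hN0⟩
    have hsc : (s : ℂ) ≠ 0 := by exact_mod_cast hs.ne'
    obtain ⟨x, y, z, hx, hy, hz, hle⟩ := exists_trilinear_ge (fun i j k => t i j k / s) (by
      simp only [norm_div, div_pow, Complex.norm_real, Real.norm_of_nonneg hs.le, hsN,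
        ← Finset.sum_div]
      exact div_self h.ne')
    refine ⟨x, y, z, hx, hy, hz, ?_⟩
    have heq : ∑ i, ∑ j, ∑ k, t i j k * x i * y j * z k
        = s * ∑ i, ∑ j, ∑ k, t i j k / s * x i * y j * z k := by
      simp only [Finset.mul_sum]
      refine Finset.sum_congr rfl fun i _ => Finset.sum_congr rfl fun j _ =>
        Finset.sum_congr rfl fun k _ => ?_
      field_simp
    rw [heq, norm_mul, mul_pow, Complex.norm_real, Real.norm_of_nonneg hs.le, hsN]
    nlinarith

theorem spectralNorm_three_ge (X : Tensor (qubits 3)) : 2 / 3 * ‖X‖ ≤ spectralNorm X := by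
  obtain ⟨x, y, z, hx, hy, hz, h⟩ := exists_trilinear_ge_mul fun i j k => X ![i, j, k]
  refine le_of_sq_le_sq ?_ (spectralNorm_nonneg X)
  refine le_spectralNorm_sq_of_form X ![x, y, z]
    (by intro j; fin_cases j <;> assumption) ?_
  rw [mul_pow, EuclideanSpace.norm_sq_eq]
  rw [sum_qubits_three, sum_qubits_three]
  simp only [Fin.prod_univ_three, Matrix.cons_val]
  simp only [← mul_assoc] at h ⊢
  norm_num at h ⊢
  exact h

/-- One of the two slices along the first qubit has at least half the squared norm; a basis vector
in the first slot selects it, and the 3-qubit bound applies. -/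
theorem spectralNorm_four_ge (X : Tensor (qubits 4)) : Real.sqrt 2 / 3 * ‖X‖ ≤ spectralNorm X := by
  have hX : ‖X‖ ^ 2 =
      ∑ a : Fin 2, ∑ b : Fin 2, ∑ c : Fin 2, ∑ e : Fin 2, ‖X ![a, b, c, e]‖ ^ 2 := by
    rw [EuclideanSpace.norm_sq_eq, sum_qubits_four]
  obtain ⟨a, ha⟩ : ∃ a : Fin 2, ‖X‖ ^ 2 / 2 ≤
      ∑ b : Fin 2, ∑ c : Fin 2, ∑ e : Fin 2, ‖X ![a, b, c, e]‖ ^ 2 := by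
    by_contra hcon
    push Not at hcon
    have h0 := hcon 0
    have h1 := hcon 1
    rw [Fin.sum_univ_two] at hX
    linarith
  obtain ⟨x, y, z, hx, hy, hz, h⟩ := exists_trilinear_ge_mul fun i j k => X ![a, i, j, k]
  refine le_of_sq_le_sq ?_ (spectralNorm_nonneg X)
  refine le_spectralNorm_sq_of_form X ![Pi.single a 1, x, y, z]
    (by intro j; fin_cases j <;> simp [hx, hy, hz]) ?_
  have hsingle : ∑ i, ‖(Pi.single a 1 : Fin 2 → ℂ) i‖ ^ 2 = 1 := by
    fin_cases a <;> simp [Fin.sum_univ_two]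
  have hform : ∑ i, X i * ∏ j, (![Pi.single a 1, x, y, z] : Fin 4 → Fin 2 → ℂ) j (i j)
      = ∑ i, ∑ j, ∑ k, X ![a, i, j, k] * x i * y j * z k := by
    rw [sum_qubits_four, Finset.sum_eq_single a]
    · simp [Fin.prod_univ_four, mul_assoc]
    · intro b _ hb
      simp [Fin.prod_univ_four, hb]
    · simp
  rw [hform]
  refine le_trans ?_ h
  simp only [Fin.prod_univ_four, Matrix.cons_val, hsingle, one_mul]
  refine mul_le_mul_of_nonneg_right ?_ (by positivity)
  have h2 : Real.sqrt 2 ^ 2 = 2 := Real.sq_sqrt (by norm_num)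
  rw [mul_pow, div_pow, h2]
  linarith

/-! ### The extremal states -/

theorem inner_pureTensor_ket {d : ℕ} (x : Fin d → EuclideanSpace ℂ (Fin 2)) (b : Fin d → Fin 2) :
    inner ℂ (pureTensor (n := qubits d) x) (ket b) = ∏ j, starRingEnd ℂ (x j (b j)) := by
  simp [ket, EuclideanSpace.inner_single_right, pureTensor]

/-- The three-qubit state `W`. -/
noncomputable def wState : Tensor (qubits 3) :=
  (1 / (Real.sqrt 3 : ℂ)) • (ket ![1, 0, 0] + ket ![0, 1, 0] + ket ![0, 0, 1])

theorem norm_wState : ‖wState‖ = 1 := by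
  have h : ‖wState‖ ^ 2 = 1 := by
    rw [EuclideanSpace.norm_sq_eq, sum_qubits_three]
    simp [wState, ket, Fin.sum_univ_two]
    norm_num
  exact (pow_eq_one_iff_of_nonneg (norm_nonneg _) two_ne_zero).1 h

theorem spectralNorm_wState_le : spectralNorm wState ≤ 2 / 3 := by
  refine spectralNorm_le (by norm_num) ?_
  rintro _ ⟨x, hx, rfl⟩
  have hx' : ∀ j, ‖x j 0‖ ^ 2 + ‖x j 1‖ ^ 2 = 1 := fun j => by
    rw [← Fin.sum_univ_two (fun i => ‖x j i‖ ^ 2), ← EuclideanSpace.norm_sq_eq, hx, one_pow]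
  refine le_of_sq_le_sq ?_ (by norm_num)
  have hform : inner ℂ (pureTensor x) wState = (1 / (Real.sqrt 3 : ℂ)) *
      starRingEnd ℂ (x 0 1 * x 1 0 * x 2 0 + x 0 0 * x 1 1 * x 2 0 + x 0 0 * x 1 0 * x 2 1) := by
    simp only [wState, inner_smul_right, inner_add_right, inner_pureTensor_ket,
      Fin.prod_univ_three, Matrix.cons_val, map_add, map_mul]
  have hsqrt : ‖(1 / (Real.sqrt 3 : ℂ))‖ ^ 2 = 1 / 3 := by
    rw [norm_div, norm_one, Complex.norm_real, Real.norm_of_nonneg (Real.sqrt_nonneg _), div_pow,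
      Real.sq_sqrt (by norm_num)]
    norm_num
  rw [hform, norm_mul, mul_pow, hsqrt, RCLike.norm_conj]
  have h1 := w_form_sq_le (hx' 0) (hx' 1) (hx' 2)
  have h2 := norm_add₃_le (a := x 0 1 * x 1 0 * x 2 0) (b := x 0 0 * x 1 1 * x 2 0)
    (c := x 0 0 * x 1 0 * x 2 1)
  simp only [norm_mul] at h2
  have h3 := pow_le_pow_left₀ (norm_nonneg _) h2 2
  linarith

theorem zeta_eq : zeta = Complex.exp (2 * Real.pi * Complex.I / (3 : ℕ)) := by
  simp [zeta]

theorem norm_zeta : ‖zeta‖ = 1 := by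
  rw [zeta_eq]
  exact (Complex.isPrimitiveRoot_exp 3 (by norm_num)).norm'_eq_one (by norm_num)

theorem one_add_zeta_add_sq : 1 + zeta + zeta ^ 2 = 0 := by
  have h := (Complex.isPrimitiveRoot_exp 3 (by norm_num)).geom_sum_eq_zero (by norm_num)
  rw [← zeta_eq] at h
  simpa [Finset.sum_range_succ] using h

theorem norm_higuchiSudbery : ‖higuchiSudbery‖ = 1 := by
  have h : ‖higuchiSudbery‖ ^ 2 = 1 := by
    rw [EuclideanSpace.norm_sq_eq, sum_qubits_four]
    simp [higuchiSudbery, ket, Fin.sum_univ_two, norm_zeta]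
    norm_num
  exact (pow_eq_one_iff_of_nonneg (norm_nonneg _) two_ne_zero).1 h

/-- The quadrilinear form of the Higuchi-Sudbery state is invariant under `SU(2)`; after moving the
first argument to a basis vector it becomes the form of the `W` state. -/
theorem higuchiSudbery_form_sq_le {x x' y y' z z' w w' : ℂ} (hx : ‖x‖ ^ 2 + ‖x'‖ ^ 2 = 1)
    (hy : ‖y‖ ^ 2 + ‖y'‖ ^ 2 = 1) (hz : ‖z‖ ^ 2 + ‖z'‖ ^ 2 = 1) (hw : ‖w‖ ^ 2 + ‖w'‖ ^ 2 = 1) :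
    ‖x * y * z' * w' + x' * y' * z * w + zeta * (x' * y * z' * w + x * y' * z * w')
      + zeta ^ 2 * (x' * y * z * w' + x * y' * z' * w)‖ ^ 2 ≤ 4 / 3 := by
  have hxc : starRingEnd ℂ x * x + starRingEnd ℂ x' * x' = 1 := by
    rw [Complex.conj_mul', Complex.conj_mul']
    exact_mod_cast hx
  have hunit : ∀ {a b : ℂ}, ‖a‖ ^ 2 + ‖b‖ ^ 2 = 1 →
      ‖x * b - x' * a‖ ^ 2 + ‖starRingEnd ℂ x * a + starRingEnd ℂ x' * b‖ ^ 2 = 1 := by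
    intro a b hab
    have : ‖x * b - x' * a‖ ^ 2 + ‖starRingEnd ℂ x * a + starRingEnd ℂ x' * b‖ ^ 2
        = (‖x‖ ^ 2 + ‖x'‖ ^ 2) * (‖a‖ ^ 2 + ‖b‖ ^ 2) := by
      simp only [Complex.sq_norm, Complex.normSq_apply, Complex.mul_re,
        Complex.mul_im, Complex.add_re, Complex.add_im, Complex.sub_re, Complex.sub_im,
        Complex.conj_re, Complex.conj_im]
      ring
    rw [this, hx, hab, one_mul]
  have h1 := w_form_sq_le (hunit hy) (hunit hz) (hunit hw)
  set Y := starRingEnd ℂ x * y + starRingEnd ℂ x' * y' with hY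
  set Z := starRingEnd ℂ x * z + starRingEnd ℂ x' * z' with hZ
  set W := starRingEnd ℂ x * w + starRingEnd ℂ x' * w' with hW
  set Y' := x * y' - x' * y with hY'
  set Z' := x * z' - x' * z with hZ'
  set W' := x * w' - x' * w with hW'
  have hyw : y * w' - y' * w = Y * W' - W * Y' := by
    simp only [hY, hW, hY', hW']
    linear_combination (-(y * w' - y' * w)) * hxc
  have hzw : z * w' - z' * w = Z * W' - W * Z' := by
    simp only [hZ, hW, hZ', hW']
    linear_combination (-(z * w' - z' * w)) * hxc
  have hζ := one_add_zeta_add_sq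
  have hform : x * y * z' * w' + x' * y' * z * w + zeta * (x' * y * z' * w + x * y' * z * w')
      + zeta ^ 2 * (x' * y * z * w' + x * y' * z' * w)
      = Y * Z' * W' + zeta * (Y' * Z * W') + zeta ^ 2 * (Y' * Z' * W) := by
    -- Eliminating `zeta ^ 2` by `1 + zeta + zeta ^ 2 = 0` leaves products of the brackets `[x, z]
    -- [y, w]` and `[x, y] [z, w]`. Expanded in the frame of `x`, they yield three monomials of `W`
    -- type with unimodular coefficients.
    have h2 : x * y * z' * w' + x' * y' * z * w + zeta * (x' * y * z' * w + x * y' * z * w')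
        + zeta ^ 2 * (x' * y * z * w' + x * y' * z' * w)
        = Z' * (y * w' - y' * w) + zeta * (Y' * (z * w' - z' * w)) := by
      simp only [hY', hZ']
      linear_combination (x' * y * z * w' + x * y' * z' * w) * hζ
    rw [h2, hyw, hzw]
    linear_combination (-(Y' * Z' * W)) * hζ
  rw [hform]
  have h2 := norm_add₃_le (a := Y * Z' * W') (b := zeta * (Y' * Z * W'))
    (c := zeta ^ 2 * (Y' * Z' * W))
  simp only [norm_mul, norm_pow, norm_zeta, one_pow, one_mul] at h2
  exact (pow_le_pow_left₀ (norm_nonneg _) h2 2).trans h1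

theorem spectralNorm_higuchiSudbery_le : spectralNorm higuchiSudbery ≤ Real.sqrt 2 / 3 := by
  refine spectralNorm_le (by positivity) ?_
  rintro _ ⟨x, hx, rfl⟩
  have hx' : ∀ j, ‖starRingEnd ℂ (x j 0)‖ ^ 2 + ‖starRingEnd ℂ (x j 1)‖ ^ 2 = 1 := fun j => by
    rw [RCLike.norm_conj, RCLike.norm_conj, ← Fin.sum_univ_two (fun i => ‖x j i‖ ^ 2),
      ← EuclideanSpace.norm_sq_eq, hx, one_pow]
  refine le_of_sq_le_sq ?_ (by positivity)
  have hsqrt : ‖(1 / (Real.sqrt 6 : ℂ))‖ ^ 2 = 1 / 6 := by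
    rw [norm_div, norm_one, Complex.norm_real, Real.norm_of_nonneg (Real.sqrt_nonneg _), div_pow,
      Real.sq_sqrt (by norm_num)]
    norm_num
  have h := higuchiSudbery_form_sq_le (hx' 0) (hx' 1) (hx' 2) (hx' 3)
  simp only [higuchiSudbery, inner_smul_right, inner_add_right, inner_pureTensor_ket,
    Fin.prod_univ_four, Matrix.cons_val]
  rw [norm_mul, mul_pow, hsqrt, div_pow, Real.sq_sqrt (by norm_num)]
  linarith

end TensorEntanglement

theorem theorem3p5 :
    TensorEntanglement.spectralNorm TensorEntanglement.higuchiSudbery = Real.sqrt 2 / 3 ∧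
    Real.sqrt 2 / 3 =
      1 / Real.sqrt 2 * TensorEntanglement.alphaSpectral (TensorEntanglement.qubits 3) ∧
    TensorEntanglement.alphaSpectral (TensorEntanglement.qubits 4) = Real.sqrt 2 / 3 ∧
    TensorEntanglement.betaNuclear (TensorEntanglement.qubits 4) = 3 / Real.sqrt 2 ∧
    TensorEntanglement.nuclearNorm TensorEntanglement.higuchiSudbery =
      TensorEntanglement.betaNuclear (TensorEntanglement.qubits 4) ∧
    TensorEntanglement.IsMaximallyGeometricallyEntangled TensorEntanglement.higuchiSudbery := by
  open TensorEntanglement in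
  have hpos : 0 < Real.sqrt 2 / 3 := by positivity
  have hne := productStates_qubits_nonempty 4
  have hspec : spectralNorm higuchiSudbery = Real.sqrt 2 / 3 :=
    le_antisymm spectralNorm_higuchiSudbery_le
      (by simpa [norm_higuchiSudbery] using spectralNorm_four_ge higuchiSudbery)
  have hnuc : nuclearNorm higuchiSudbery = 3 / Real.sqrt 2 := by
    rw [← inv_div]
    exact le_antisymm (nuclearNorm_le_inv hne hpos spectralNorm_four_ge norm_higuchiSudbery)
      (inv_le_nuclearNorm hne hpos spectralNorm_four_ge norm_higuchiSudbery hspec.le)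
  have hbeta : betaNuclear (qubits 4) = 3 / Real.sqrt 2 := by
    refine IsGreatest.csSup_eq ⟨⟨_, norm_higuchiSudbery, hnuc⟩, ?_⟩
    rintro _ ⟨Y, hY, rfl⟩
    rw [← inv_div]
    exact nuclearNorm_le_inv hne hpos spectralNorm_four_ge hY
  refine ⟨hspec, ?_, alphaSpectral_eq spectralNorm_four_ge norm_higuchiSudbery hspec.le, hbeta,
    hnuc.trans hbeta.symm, norm_higuchiSudbery, fun Y hY => ?_⟩
  · rw [alphaSpectral_eq spectralNorm_three_ge norm_wState spectralNorm_wState_le]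
    field_simp
    norm_num
  · rw [geometricEntanglement_eq hne hY, geometricEntanglement_eq hne norm_higuchiSudbery]
    apply Real.sqrt_le_sqrt
    have h := spectralNorm_four_ge Y
    rw [hY, mul_one] at h
    linarith
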